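/- Let $p>q$ be prime numbers, let $g\ge 1$ be an integer, and put $n=gq+1$. Let $e$ be the least positive integer with $p^e\equiv 1 \pmod q$. Assume that $p^e>n$ and $p\ge n+q-2$. For $s\ge 1$ put $$\Phi_s(t,z)=\big((t-z_1)\cdots(t-z_n)\big)^{(p^{es}-1)/q}\in\mathbb Z[z_1,\dots,z_n][t].$$ Let $A_s(z)$ be the $g\times g$ Hasse--Witt matrix whose $(u,v)$ entry ($1\le u,v\le g$) is the coefficient of $t^{p^{es}v-u}$ in $\Phi_s(t,z)$. Let $I_s(z)$ be the $n\times g$ matrix whose $(i,\ell)$ entry ($1\le i\le n$, $1\le \ell\le g$) is the coefficient of $t^{\ell p^{es}-1}$ in $\Phi_s(t,z)/(t-z_i)$. Let $m\ge 1$, let $K=\mathbb Q_p^{(m)}$ be the unramified extension of $\mathbb Q_p$ of degree $m$, with the norm $|\cdot|_p$ that extends the $p$-adic norm, and let $\mathbb Z_p^{(m)}=\{x\in K: |x|_p\le 1\}$. Define $$\mathfrak D=\mathfrak D^{(m)}_{\mathrm{KZ}}=\{a\in(\mathbb Z_p^{(m)})^n : |\det A_1(a)|_p=1\},\qquad \mathfrak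 D^{o}=\mathfrak D^{(m),o}_{\mathrm{KZ}}=\{a\in\mathfrak D : a_i\ne a_j \text{ for all } i\neq j\},$$ and $W=\{(x_1,\dots,x_n)\in K^n : x_1+\dots+x_n=0\}$. Then: 1. $|\det A_s(a)|_p=1$ for all $s\ge1$ and $a\in\mathfrak D$; the matrices $I_s(a)A_s(a)^{-1}$ converge as $s\to\infty$, uniformly on $\mathfrak D$, to an $n\times g$ matrix $\mathcal I(a)$; the entries of $\mathcal I$ are analytic at every point of $\mathfrak D$; and for every $a\in\mathfrak D$ the subspace $\mathcal L_a\subset K^n$ spanned by the columns of $\mathcal I(a)$ is contained in $W$. 2. The function $a\mapsto \dim_{K}\mathcal L_a$ is constant on $\mathfrak D^{o}$, say equal to $r$, and $\mathcal L=\bigcup_a\mathcal L_a$ is an analytic vector subbundle of rank $r$ of the trivial bundle over $\mathfrak D^{o}$: every point of $\mathfrak D^{o}$ has an open neighbourhood $U\subset\mathfrak D^{o}$ with analytic maps $s_1,\dots,s_r:U\to K^n$ such that $s_1(x),\dots,s_r(x)$ is a basis of $\mathcal L_x$ for every $x\in U$. -/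

import Mathlib

open Filter Topology

noncomputable section

namespace PadicKZ

/-- The unramified extension of `ℚ_p` of degree `m` inside the algebraic closure of `ℚ_p`: it is
obtained by adjoining the primitive roots of unity of order `p ^ m - 1`. As a subfield of
`PadicAlgCl p` it carries the norm that extends the `p`-adic norm. -/
def UnramifiedExt (p m : ℕ) [Fact p.Prime] : IntermediateField ℚ_[p] (PadicAlgCl p) :=
  IntermediateField.adjoin ℚ_[p] {ζ : PadicAlgCl p | IsPrimitiveRoot ζ (p ^ m - 1)}

/-- The order of `p` modulo `q`: the least positive `e` with `p ^ e ≡ 1` modulo `q`. -/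
def ordMod (p q : ℕ) : ℕ := orderOf (p : ZMod q)

/-- The exponent `(p ^ (e s) - 1) / q` of the master polynomial, where `e` is the order of `p`
modulo `q`; the division is exact. -/
def masterExp (p q s : ℕ) : ℕ := (p ^ (ordMod p q * s) - 1) / q

theorem masterExp_mul {p q s : ℕ} (hp : 0 < p) : masterExp p q s * q + 1 = p ^ (ordMod p q * s) := by
  have h1 : ((p ^ (ordMod p q * s) : ℕ) : ZMod q) = 1 := by
    rw [Nat.cast_pow, pow_mul, ordMod, pow_orderOf_eq_one, one_pow]
  have h2 : 1 ≤ p ^ (ordMod p q * s) := Nat.one_le_pow _ _ hp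
  have h3 : q ∣ p ^ (ordMod p q * s) - 1 := by
    rw [← ZMod.natCast_eq_zero_iff, Nat.cast_sub h2, h1, Nat.cast_one, sub_self]
  rw [masterExp, Nat.div_mul_cancel h3]
  omega

/-- The polynomial `((t - z_1) ⋯ (t - z_n)) ^ N` in `ℤ[z_1, …, z_n][t]`. -/
def powProd (n N : ℕ) : Polynomial (MvPolynomial (Fin n) ℤ) :=
  ∏ j : Fin n, (Polynomial.X - Polynomial.C (MvPolynomial.X j)) ^ N

/-- The quotient of `((t - z_1) ⋯ (t - z_n)) ^ N` by `t - z_i` (for `0 < N`). -/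
def powProdQuot (n N : ℕ) (i : Fin n) : Polynomial (MvPolynomial (Fin n) ℤ) :=
  (Polynomial.X - Polynomial.C (MvPolynomial.X i)) ^ (N - 1) *
    ∏ j ∈ Finset.univ.erase i, (Polynomial.X - Polynomial.C (MvPolynomial.X j)) ^ N

theorem mul_powProdQuot {n N : ℕ} (hN : 0 < N) (i : Fin n) :
    (Polynomial.X - Polynomial.C (MvPolynomial.X i)) * powProdQuot n N i = powProd n N := by
  rw [powProdQuot, ← mul_assoc, ← pow_succ', Nat.sub_add_cancel hN, powProd]
  exact Finset.mul_prod_erase Finset.univ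
    (fun j : Fin n => (Polynomial.X - Polynomial.C (MvPolynomial.X j) :
      Polynomial (MvPolynomial (Fin n) ℤ)) ^ N) (Finset.mem_univ i)

/-- The master polynomial
`Φ_s(t, z) = ((t - z_1) ⋯ (t - z_n)) ^ ((p ^ (e s) - 1) / q)` with `n = g q + 1`. -/
def masterPoly (p q g s : ℕ) : Polynomial (MvPolynomial (Fin (g * q + 1)) ℤ) :=
  powProd (g * q + 1) (masterExp p q s)

/-- The Hasse--Witt matrix `A(Φ_s)`: for `u, v = 1, …, g` its `(u, v)` entry is the coefficient of
`t ^ (p ^ (e s) v - u)` in `Φ_s(t, z)` (the indices `u, v` below start at `0`). -/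
def hasseWitt (p q g s : ℕ) : Matrix (Fin g) (Fin g) (MvPolynomial (Fin (g * q + 1)) ℤ) :=
  Matrix.of fun u v =>
    (masterPoly p q g s).coeff (p ^ (ordMod p q * s) * ((v : ℕ) + 1) - ((u : ℕ) + 1))

/-- The matrix `I_s(z)` of `p ^ (e s)`-hypergeometric solutions: for `ℓ = 1, …, g` its `(i, ℓ)`
entry is the coefficient of `t ^ (ℓ p ^ (e s) - 1)` in `Φ_s(t, z) / (t - z_i)` (the index `ℓ` below
starts at `0`). -/
def hypergeomSol (p q g s : ℕ) :
    Matrix (Fin (g * q + 1)) (Fin g) (MvPolynomial (Fin (g * q + 1)) ℤ) :=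
  Matrix.of fun i l =>
    (powProdQuot (g * q + 1) (masterExp p q s) i).coeff
      (((l : ℕ) + 1) * p ^ (ordMod p q * s) - 1)

/-- The value at a point `a ∈ K ^ n` of a matrix of polynomials with integer coefficients. -/
def evalMatrix {K : Type*} [Field K] {n : ℕ} {α β : Type*}
    (M : Matrix α β (MvPolynomial (Fin n) ℤ)) (a : Fin n → K) : Matrix α β K :=
  M.map (MvPolynomial.aeval a)

/-- The domain of `a ∈ K ^ n` with `|a_i| ≤ 1` for all `i` and `|det A(Φ_1)(a)| = 1`. -/
def kzDomain (p q g : ℕ) (K : Type*) [NormedField K] : Set (Fin (g * q + 1) → K) :=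
  {a | (∀ i, ‖a i‖ ≤ 1) ∧ ‖(evalMatrix (hasseWitt p q g 1) a).det‖ = 1}

/-- The part of `kzDomain` in the complement of the diagonal hyperplanes. -/
def kzDomainOff (p q g : ℕ) (K : Type*) [NormedField K] : Set (Fin (g * q + 1) → K) :=
  {a | a ∈ kzDomain p q g K ∧ ∀ i j, i ≠ j → a i ≠ a j}

/-- The matrix `I_s(a) ⬝ A(Φ_s)(a)⁻¹`. -/
def normalizedSol {K : Type*} [Field K] (p q g s : ℕ) (a : Fin (g * q + 1) → K) :
    Matrix (Fin (g * q + 1)) (Fin g) K :=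
  evalMatrix (hypergeomSol p q g s) a * (evalMatrix (hasseWitt p q g s) a)⁻¹

/-- The matrix `𝓘(a)`, the entrywise limit of `I_s(a) ⬝ A(Φ_s)(a)⁻¹` as `s → ∞`. -/
def limitSol {K : Type*} [NormedField K] (p q g : ℕ) (a : Fin (g * q + 1) → K) :
    Matrix (Fin (g * q + 1)) (Fin g) K :=
  Matrix.of fun i l => limUnder atTop fun s : ℕ => normalizedSol p q g s a i l

/-- The fiber `W = {(I_1, …, I_n) | I_1 + ⋯ + I_n = 0}` of the trivial bundle. -/
def sumZero (n : ℕ) (K : Type*) [Field K] : Submodule K (Fin n → K) where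
  carrier := {x | ∑ i, x i = 0}
  add_mem' {x y} hx hy := by
    have hx' : ∑ i, x i = 0 := hx
    have hy' : ∑ i, y i = 0 := hy
    simp [Finset.sum_add_distrib, hx', hy']
  zero_mem' := by simp
  smul_mem' c x hx := by
    have hx' : ∑ i, x i = 0 := hx
    simp [← Finset.mul_sum, hx']

/-- The space `𝓛_a`, spanned by the columns of the matrix `𝓘(a)`. -/
def fiberL {K : Type*} [NormedField K] (p q g : ℕ) (a : Fin (g * q + 1) → K) :
    Submodule K (Fin (g * q + 1) → K) :=
  Submodule.span K (Set.range (limitSol p q g a).col)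

/-- A family of subspaces `L a` of a normed space `E` is an analytic vector subbundle of rank `r`
of the trivial bundle with fiber `E` over `D`, if around every point of `D` it has an analytic
frame: analytic sections `s_1, …, s_r` whose values at each point form a basis of the fiber. -/
def IsAnalyticSubbundle {K V E : Type*} [NontriviallyNormedField K] [NormedAddCommGroup V]
    [NormedSpace K V] [NormedAddCommGroup E] [NormedSpace K E]
    (D : Set V) (L : V → Submodule K E) (r : ℕ) : Prop :=
  ∀ a ∈ D, ∃ U : Set V, IsOpen U ∧ a ∈ U ∧ U ⊆ D ∧ ∃ s : Fin r → V → E,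
    (∀ j, AnalyticOnNhd K (s j) U) ∧
    ∀ x ∈ U, LinearIndependent K (fun j => s j x) ∧
      Submodule.span K (Set.range fun j => s j x) = L x

end PadicKZ

end

/-!
The columns of `I_s(a) A_s(a)⁻¹` are the values, on the products of the `t - a_j` with `j ≠ i`, of
the functionals `f ↦ [t ^ (ℓ p ^ (e s) - 1)] (P ^ (N_s - 1) f)`, where `P = ∏ (t - a_j)` and
`N_s = (p ^ (e s) - 1) / q`, normalized so as to be dual to the test polynomials `P t ^ u`.
Dwork congruences, valid over any ring with `p` regular and in the Jacobson radical, say that the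
normalized functionals of levels `s` and `s + 1` agree modulo `p ^ s`. Over the ring of power series
in a formal neighbourhood of `a` they give the uniform limit and its analyticity at once.

The limit functionals vanish on the polynomials `q P f' - P' f`, because
`P ^ (N_s - 1) (q P f' - P' f)` is a derivative modulo `p ^ (e s)`. For `f = 1` this says that
the columns have sum zero. If the `a_j` are distinct, the polynomials `P / (t - a_i)` and
`q P f' - P' f` span `K[t]`, since `q` does not divide `deg P = g q + 1`. A linear relation between
the columns of the limit would thus be one between the limit functionals, but these are dual to the
test polynomials. Hence the rank is `g`.
-/

noncomputable section

namespace PadicKZ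

open Polynomial Finset nonZeroDivisors

section DualFamily

variable {R E ι : Type*} [CommRing R] [AddCommGroup E] [Module R E]

/-- The matrix of values of the functionals `lam v` on the test vectors `w u`. -/
def valueMatrix (w : ι → E) (lam : ι → E →ₗ[R] R) : Matrix ι ι R :=
  Matrix.of fun u v => lam v (w u)

variable [Fintype ι]

/-- The functionals on `E` that are determined, modulo `I` and on `W`, by their values on the
test vectors `w u`, with `ν u` in the role of the functional dual to `w u`. This is how congruences
between functionals are expressed. -/
def determinedBy (W : Submodule R E) (I : Ideal R) (w : ι → E) (ν : ι → E →ₗ[R] R) :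
    Submodule R (E →ₗ[R] R) where
  carrier := {φ | ∀ f ∈ W, φ f - ∑ u, φ (w u) * ν u f ∈ I}
  add_mem' {φ ψ} hφ hψ f hf := by
    simpa [add_mul, Finset.sum_add_distrib, add_sub_add_comm] using I.add_mem (hφ f hf) (hψ f hf)
  zero_mem' f _ := by simp
  smul_mem' r φ hφ f hf := by
    simpa [mul_assoc, ← Finset.mul_sum, ← mul_sub] using I.mul_mem_left r (hφ f hf)

variable {W : Submodule R E} {I J : Ideal R} {w : ι → E} {lam ν : ι → E →ₗ[R] R} {φ : E →ₗ[R] R}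

theorem mem_determinedBy_of_forall_mem (hw : ∀ u, w u ∈ W) (hφ : ∀ f ∈ W, φ f ∈ I) :
    φ ∈ determinedBy W I w ν := fun f hf =>
  I.sub_mem (hφ f hf) (I.sum_mem fun u _ => I.mul_mem_right _ (hφ _ (hw u)))

theorem smul_mem_determinedBy {x : R} (hx : x ∈ J) (hφ : φ ∈ determinedBy W I w ν) :
    x • φ ∈ determinedBy W (J * I) w ν := fun f hf => by
  simpa [mul_assoc, ← Finset.mul_sum, ← mul_sub] using Ideal.mul_mem_mul hx (hφ f hf)

variable [DecidableEq ι]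

/-- The combinations of the functionals `lam v` that are dual to the test vectors `w u`; meaningful
when the matrix of values is invertible. -/
def dualFamily (w : ι → E) (lam : ι → E →ₗ[R] R) (u : ι) : E →ₗ[R] R :=
  ∑ v, (valueMatrix w lam)⁻¹ v u • lam v

theorem dualFamily_apply (u : ι) (f : E) :
    dualFamily w lam u f = ∑ v, lam v f * (valueMatrix w lam)⁻¹ v u := by
  simp [dualFamily, mul_comm]

theorem dualFamily_apply_test (h : IsUnit (valueMatrix w lam).det) (l u : ι) :
    dualFamily w lam l (w u) = (1 : Matrix ι ι R) u l := by
  rw [dualFamily_apply, ← Matrix.mul_nonsing_inv _ h, Matrix.mul_apply]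
  rfl

theorem sum_apply_mul_dualFamily (h : IsUnit (valueMatrix w lam).det) (v : ι) (f : E) :
    ∑ u, lam v (w u) * dualFamily w lam u f = lam v f := by
  calc ∑ u, lam v (w u) * dualFamily w lam u f
      = ∑ v', lam v' f * ((valueMatrix w lam)⁻¹ * valueMatrix w lam) v' v := by
        simp only [dualFamily_apply, Matrix.mul_apply, Finset.mul_sum, valueMatrix, Matrix.of_apply]
        rw [Finset.sum_comm]
        exact Finset.sum_congr rfl fun _ _ => Finset.sum_congr rfl fun _ _ => by ring
    _ = lam v f := by simp [Matrix.nonsing_inv_mul _ h, Matrix.one_apply]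

theorem self_mem_determinedBy (h : IsUnit (valueMatrix w lam).det) (v : ι) :
    lam v ∈ determinedBy W I w (dualFamily w lam) := fun f _ => by
  simp [sum_apply_mul_dualFamily h]

theorem dualFamily_sub_mem (h : IsUnit (valueMatrix w lam).det)
    (hlam : ∀ v, lam v ∈ determinedBy W I w ν) (u : ι) {f : E} (hf : f ∈ W) :
    dualFamily w lam u f - ν u f ∈ I := by
  have hmem : dualFamily w lam u ∈ determinedBy W I w ν :=
    Submodule.sum_mem _ fun v _ => Submodule.smul_mem _ _ (hlam v)
  simpa [dualFamily_apply_test h, Matrix.one_apply] using hmem f hf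

theorem determinedBy_le_dualFamily (h : IsUnit (valueMatrix w lam).det)
    (hlam : ∀ v, lam v ∈ determinedBy W I w ν) :
    determinedBy W I w ν ≤ determinedBy W I w (dualFamily w lam) := fun φ hφ f hf => by
  have hdiff : ∑ u, φ (w u) * (dualFamily w lam u f - ν u f) ∈ I :=
    I.sum_mem fun u _ => I.mul_mem_left _ (dualFamily_sub_mem h hlam u hf)
  simpa [mul_sub, Finset.sum_sub_distrib] using I.sub_mem (hφ f hf) hdiff

end DualFamily

section CoeffMul

variable {R : Type*} [CommRing R]

/-- The functional `f ↦ [t ^ i] (G f)` on polynomials. -/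
def coeffMul (G : R[X]) (i : ℕ) : R[X] →ₗ[R] R :=
  (lcoeff R i).comp (LinearMap.mulLeft R G)

@[simp]
theorem coeffMul_apply (G : R[X]) (i : ℕ) (f : R[X]) : coeffMul G i f = (G * f).coeff i :=
  rfl

theorem coeffMul_mul (G F : R[X]) (i : ℕ) :
    coeffMul (G * F) i = ∑ x ∈ antidiagonal i, F.coeff x.2 • coeffMul G x.1 := by
  refine LinearMap.ext fun f => ?_
  rw [LinearMap.sum_apply, coeffMul_apply, mul_right_comm, coeff_mul]
  exact Finset.sum_congr rfl fun x _ => by simp [mul_comm]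

end CoeffMul

section CoeffPow

variable {R : Type*} [CommRing R] {p : ℕ}

theorem exists_pow_dvd_of_pow_dvd_natCast_mul (hp : p.Prime) (hpR : (p : R) ∈ R⁰) {m b : ℕ} {x : R}
    (h : (p : R) ^ m ∣ b * x) : ∃ i ≤ m, p ^ i ∣ b ∧ (p : R) ^ (m - i) ∣ x := by
  induction m generalizing b with
  | zero => exact ⟨0, le_rfl, by simp, by simp⟩
  | succ m ih =>
    by_cases hb : p ∣ b
    · obtain ⟨b, rfl⟩ := hb
      rw [pow_succ', Nat.cast_mul, mul_assoc, dvd_cancel_left_mem_nonZeroDivisors hpR] at h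
      obtain ⟨i, him, hib, hix⟩ := ih h
      exact ⟨i + 1, by omega, pow_succ' p i ▸ mul_dvd_mul_left p hib, by
        rwa [Nat.add_sub_add_right]⟩
    · have hcop : IsCoprime ((p : R) ^ (m + 1)) (b : R) :=
        ((Nat.Prime.coprime_iff_not_dvd hp).2 hb).cast.pow_left
      exact ⟨0, Nat.zero_le _, by simp, hcop.dvd_of_dvd_mul_left h⟩

theorem natCast_dvd_mul_coeff_pow (H : R[X]) (n b : ℕ) : (n : R) ∣ b * (H ^ n).coeff b := by
  obtain _ | b := b
  · simp
  · have h := coeff_derivative (H ^ n) b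
    rw [derivative_pow, mul_assoc, coeff_C_mul] at h
    exact ⟨_, by rw [mul_comm, Nat.cast_succ, ← h]⟩

theorem exists_pow_dvd_coeff_pow (hp : p.Prime) (hpR : (p : R) ∈ R⁰) {e : ℕ} (he : 0 < e) (k : ℕ)
    (H : R[X]) (b : ℕ) :
    ∃ j ≤ k, (p ^ e) ^ j ∣ b ∧ (p : R) ^ (k - j) ∣ (H ^ (p ^ e) ^ k).coeff b := by
  obtain ⟨i, hi, hib, hix⟩ := exists_pow_dvd_of_pow_dvd_natCast_mul (m := e * k) hp hpR
    (by simpa [pow_mul] using natCast_dvd_mul_coeff_pow H ((p ^ e) ^ k) b)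
  have hdiv : e * (i / e) + i % e = i := Nat.div_add_mod i e
  have hmod : i % e < e := Nat.mod_lt i he
  have hik : i / e ≤ k := Nat.div_le_of_le_mul hi
  have hle : k - i / e ≤ e * k - i := by
    obtain ⟨r, rfl⟩ := Nat.exists_eq_add_of_le hik
    rw [Nat.mul_add] at hi ⊢
    obtain _ | r := r
    · omega
    · have : r ≤ e * r := Nat.le_mul_of_pos_left r he
      rw [Nat.mul_succ]
      omega
  refine ⟨i / e, hik, ?_, (pow_dvd_pow _ hle).trans hix⟩
  rw [← pow_mul]
  exact (pow_dvd_pow p (by omega)).trans hib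

end CoeffPow

/-- Exponents `N k = (Q ^ k - 1) / q`, stated without division, for a base `Q` that is large enough
for `g` residues. -/
structure ExponentData (Q q g : ℕ) (N : ℕ → ℕ) : Prop where
  mul_add_one : ∀ k, N k * q + 1 = Q ^ k
  one_lt : 1 < Q
  le : g ≤ Q

namespace ExponentData

variable {Q q g : ℕ} {N : ℕ → ℕ}

theorem q_pos (h : ExponentData Q q g N) : 0 < q := by
  refine Nat.pos_of_ne_zero fun hq => ?_
  have := h.mul_add_one 1
  have := h.one_lt
  simp_all

theorem pow_pos (h : ExponentData Q q g N) (k : ℕ) : 0 < Q ^ k :=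
  Nat.pow_pos (Nat.zero_lt_of_lt h.one_lt)

theorem lt_pow (h : ExponentData Q q g N) (k : ℕ) : N k < Q ^ k := by
  rw [← h.mul_add_one k]
  exact Nat.lt_succ_of_le (Nat.le_mul_of_pos_right _ h.q_pos)

theorem pos (h : ExponentData Q q g N) {k : ℕ} (hk : 0 < k) : 0 < N k := by
  refine Nat.pos_of_ne_zero fun h0 => ?_
  have h1 := h.mul_add_one k
  rw [h0, Nat.zero_mul, Nat.zero_add] at h1
  exact (Nat.one_lt_pow hk.ne' h.one_lt).ne h1

theorem add (h : ExponentData Q q g N) (j k : ℕ) : N (j + k) = N j + N k * Q ^ j := by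
  refine Nat.eq_of_mul_eq_mul_right h.q_pos (Nat.succ_injective ?_)
  calc N (j + k) * q + 1 = Q ^ j * (N k * q + 1) := by
        rw [h.mul_add_one, h.mul_add_one, pow_add]
    _ = N j * q + 1 + N k * q * Q ^ j := by rw [h.mul_add_one j]; ring
    _ = (N j + N k * Q ^ j) * q + 1 := by ring

theorem sub_one_add (h : ExponentData Q q g N) {j : ℕ} (hj : 0 < j) (k : ℕ) :
    N (j + k) - 1 = N j - 1 + N k * Q ^ j := by
  have := h.pos hj
  rw [h.add]
  omega

end ExponentData

section MasterFunctionals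

variable {R S : Type*} [CommRing R] [CommRing S] {Q q g : ℕ} {N : ℕ → ℕ}

/-- The functionals `f ↦ [t ^ ((v + 1) Q ^ k - 1)] (P ^ (N k - 1) f)`. A factor `t` is inserted so
that no index is a truncated difference. -/
def masterFun (Q g : ℕ) (N : ℕ → ℕ) (P : R[X]) (k : ℕ) (v : Fin g) : R[X] →ₗ[R] R :=
  coeffMul (X * P ^ (N k - 1)) (((v : ℕ) + 1) * Q ^ k)

/-- The test polynomials `P t ^ u`, `u < g`; the values of `masterFun` on them are the entries of
the Hasse--Witt matrix. -/
def testPoly (g : ℕ) (P : R[X]) (u : Fin g) : R[X] := P * X ^ (u : ℕ)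

/-- The Hasse--Witt matrix of `P ^ N k`. -/
def masterMatrix (Q g : ℕ) (N : ℕ → ℕ) (P : R[X]) (k : ℕ) : Matrix (Fin g) (Fin g) R :=
  valueMatrix (testPoly g P) (masterFun Q g N P k)

/-- The functionals `masterFun`, normalized by the inverse of the Hasse--Witt matrix. -/
def normalizedFun (Q g : ℕ) (N : ℕ → ℕ) (P : R[X]) (k : ℕ) (l : Fin g) : R[X] →ₗ[R] R :=
  dualFamily (testPoly g P) (masterFun Q g N P k) l

theorem normalizedFun_eq_sum (P f : R[X]) (k : ℕ) (l : Fin g) :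
    normalizedFun Q g N P k l f
      = ∑ v, masterFun Q g N P k v f * (masterMatrix Q g N P k)⁻¹ v l :=
  dualFamily_apply l f

theorem masterMatrix_apply (h : ExponentData Q q g N) {k : ℕ} (hk : 0 < k) (P : R[X])
    (u v : Fin g) :
    masterMatrix Q g N P k u v
      = (P ^ N k).coeff (((v : ℕ) + 1) * Q ^ k - ((u : ℕ) + 1)) := by
  have hpoly : X * P ^ (N k - 1) * testPoly g P u = X ^ ((u : ℕ) + 1) * P ^ N k := by
    rw [testPoly, ← Nat.sub_add_cancel (h.pos hk), Nat.add_sub_cancel]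
    ring
  have hle : (u : ℕ) + 1 ≤ ((v : ℕ) + 1) * Q ^ k :=
    calc (u : ℕ) + 1 ≤ Q ^ k :=
          u.2.trans_le (h.le.trans (Nat.le_self_pow hk.ne' Q))
      _ ≤ ((v : ℕ) + 1) * Q ^ k := Nat.le_mul_of_pos_left _ (Nat.succ_pos _)
  rw [masterMatrix, valueMatrix, Matrix.of_apply, masterFun, coeffMul_apply, hpoly,
    coeff_X_pow_mul', if_pos hle]

theorem masterFun_map (φ : R →+* S) (P f : R[X]) (k : ℕ) (v : Fin g) :
    masterFun Q g N (P.map φ) k v (f.map φ) = φ (masterFun Q g N P k v f) := by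
  simp only [masterFun, coeffMul_apply, ← Polynomial.coeff_map, Polynomial.map_mul,
    Polynomial.map_pow, map_X]

theorem masterMatrix_map (φ : R →+* S) (P : R[X]) (k : ℕ) :
    masterMatrix Q g N (P.map φ) k = (masterMatrix Q g N P k).map φ := by
  ext u v
  have htest : testPoly g (P.map φ) u = (testPoly g P u).map φ := by simp [testPoly]
  rw [masterMatrix, valueMatrix, Matrix.of_apply, htest, masterFun_map]
  rfl

theorem normalizedFun_map (φ : R →+* S) {P : R[X]} {k : ℕ}
    (h : IsUnit (masterMatrix Q g N P k).det) (f : R[X]) (l : Fin g) :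
    normalizedFun Q g N (P.map φ) k l (f.map φ) = φ (normalizedFun Q g N P k l f) := by
  have hinv : ((masterMatrix Q g N P k).map φ)⁻¹ = (masterMatrix Q g N P k)⁻¹.map φ := by
    refine Matrix.inv_eq_right_inv ?_
    rw [← Matrix.map_mul, Matrix.mul_nonsing_inv _ h, Matrix.map_one _ (map_zero φ) (map_one φ)]
  simp only [normalizedFun_eq_sum, masterFun_map, masterMatrix_map, hinv, map_sum, map_mul,
    Matrix.map_apply]

theorem normalizedFun_testPoly {P : R[X]} {k : ℕ} (h : IsUnit (masterMatrix Q g N P k).det)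
    (l u : Fin g) : normalizedFun Q g N P k l (testPoly g P u) = (1 : Matrix _ _ R) u l :=
  dualFamily_apply_test h l u

theorem testPoly_mem_degreeLE {P : R[X]} (hP : P.natDegree ≤ g * q + 1) (u : Fin g) :
    testPoly g P u ∈ degreeLE R (g * q + g : ℕ) := by
  rw [mem_degreeLE, ← natDegree_le_iff_degree_le]
  have h1 : (testPoly g P u).natDegree ≤ (g * q + 1) + (u : ℕ) :=
    natDegree_mul_le.trans (Nat.add_le_add hP (natDegree_X_pow_le _))
  omega

theorem coeffMul_eq_zero (h : ExponentData Q q g N) {P f : R[X]} {k v : ℕ} (hk : 0 < k)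
    (hP : P.natDegree ≤ g * q + 1) (hf : f ∈ degreeLE R (g * q + g : ℕ)) (hv : v = 0 ∨ g < v) :
    coeffMul (X * P ^ (N k - 1)) (v * Q ^ k) f = 0 := by
  rw [mem_degreeLE, ← natDegree_le_iff_degree_le] at hf
  obtain rfl | hv := hv
  · simp [mul_coeff_zero]
  refine coeff_eq_zero_of_natDegree_lt (lt_of_lt_of_le ?_ (Nat.mul_le_mul_right _ hv))
  have hdeg : (X * P ^ (N k - 1)).natDegree ≤ 1 + (N k - 1) * (g * q + 1) :=
    natDegree_mul_le.trans (Nat.add_le_add natDegree_X_le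
      (natDegree_pow_le.trans (Nat.mul_le_mul_left _ hP)))
  obtain ⟨M, hM⟩ : ∃ M, N k = M + 1 := Nat.exists_eq_succ_of_ne_zero (h.pos hk).ne'
  calc (X * P ^ (N k - 1) * f).natDegree
      ≤ 1 + (N k - 1) * (g * q + 1) + (g * q + g) :=
        natDegree_mul_le.trans (Nat.add_le_add hdeg hf)
    _ = g * (N k * q + 1) + N k := by rw [hM, Nat.add_sub_cancel]; ring
    _ < (g + 1) * Q ^ k := by
        rw [h.mul_add_one, Nat.succ_mul]
        exact Nat.add_lt_add_left (h.lt_pow k) _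

end MasterFunctionals

section Frobenius

theorem sum_antidiagonal_eq_sum_fin {M : Type*} [AddCommMonoid M] {m g : ℕ} (hg : g ≤ m)
    {f : ℕ × ℕ → M} (hf : ∀ x : ℕ × ℕ, x.1 = 0 ∨ g < x.1 → f x = 0) :
    ∑ x ∈ antidiagonal m, f x = ∑ w : Fin g, f ((w : ℕ) + 1, m - ((w : ℕ) + 1)) := by
  rw [Finset.Nat.sum_antidiagonal_eq_sum_range_succ_mk, Finset.sum_range_succ', hf _ (Or.inl rfl),
    add_zero, Fin.sum_univ_eq_sum_range (fun w => f (w + 1, m - (w + 1)))]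
  refine (Finset.sum_subset (Finset.range_subset_range.2 hg) fun w _ hw => hf _ (Or.inr ?_)).symm
  simpa [Nat.lt_succ_iff] using hw

variable {R : Type*} [CommRing R] {p e q g : ℕ} {N : ℕ → ℕ} [ExpChar R p] {P : R[X]} {k : ℕ}

-- In characteristic `p` the factor `(P ^ N 1) ^ (Q ^ k)` is a polynomial in `t ^ (Q ^ k)`.
theorem masterMatrix_succ (h : ExponentData (p ^ e) q g N)
    (hP : P.natDegree ≤ g * q + 1) (hk : 0 < k) :
    masterMatrix (p ^ e) g N P (k + 1)
      = masterMatrix (p ^ e) g N P k *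
        (masterMatrix (p ^ e) g N P 1).map (iterateFrobenius R p (e * k)) := by
  ext u v
  set Q := p ^ e with hQ
  set G := (P ^ N 1).map (iterateFrobenius R p (e * k)) with hG
  have hQk : Q ^ k ≠ 0 := (h.pow_pos k).ne'
  have hfactor : X * P ^ (N (k + 1) - 1) * testPoly g P u
      = X * P ^ (N k - 1) * testPoly g P u * expand R (Q ^ k) G := by
    rw [hG, ← map_expand, hQ, ← pow_mul, map_iterateFrobenius_expand, h.sub_one_add hk, pow_add,
      pow_mul, pow_mul p e k]
    ring
  calc masterMatrix Q g N P (k + 1) u v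
      = (contract (Q ^ k) (X * P ^ (N k - 1) * testPoly g P u) * G).coeff
          (((v : ℕ) + 1) * Q) := by
        rw [← contract_mul_expand hQk, ← hfactor, coeff_contract hQk, mul_assoc _ Q,
          ← pow_succ']
        rfl
    _ = ∑ w : Fin g, coeffMul (X * P ^ (N k - 1)) (((w : ℕ) + 1) * Q ^ k) (testPoly g P u) *
          G.coeff (((v : ℕ) + 1) * Q - ((w : ℕ) + 1)) := by
        rw [coeff_mul, sum_antidiagonal_eq_sum_fin
          (h.le.trans (Nat.le_mul_of_pos_left Q v.1.succ_pos))]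
        · simp only [coeff_contract hQk, coeffMul_apply]
        · intro x hx
          rw [coeff_contract hQk, ← coeffMul_apply,
            coeffMul_eq_zero h hk hP (testPoly_mem_degreeLE hP u) hx, zero_mul]
    _ = _ := by
        simp only [Matrix.mul_apply, Matrix.map_apply, masterMatrix_apply h one_pos, pow_one, hG,
          coeff_map]
        rfl

theorem isUnit_det_masterMatrix_of_expChar (h : ExponentData (p ^ e) q g N)
    (hP : P.natDegree ≤ g * q + 1) (hone : IsUnit (masterMatrix (p ^ e) g N P 1).det)
    (hk : 0 < k) : IsUnit (masterMatrix (p ^ e) g N P k).det := by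
  induction k, hk using Nat.le_induction with
  | base => exact hone
  | succ k hk ih =>
    rw [masterMatrix_succ h hP hk, Matrix.det_mul]
    exact ih.mul (by simpa [RingHom.map_det] using hone.map (iterateFrobenius R p (e * k)))

end Frobenius

/-- The setting of the Dwork congruences: `p` is a regular element in the Jacobson radical of `R`,
and the first Hasse--Witt matrix of `P` is invertible. -/
structure DworkData (R : Type*) [CommRing R] (p e q g : ℕ) (N : ℕ → ℕ) (P : R[X]) : Prop
    extends ExponentData (p ^ e) q g N where
  prime : p.Prime
  mem_nonZeroDivisors : (p : R) ∈ R⁰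
  mem_jacobson : (p : R) ∈ Ideal.jacobson (⊥ : Ideal R)
  natDegree_le : P.natDegree ≤ g * q + 1
  isUnit_det_one : IsUnit (masterMatrix (p ^ e) g N P 1).det

namespace DworkData

variable {R : Type*} [CommRing R] {p e q g : ℕ} {N : ℕ → ℕ} {P : R[X]} {k : ℕ}

theorem e_pos (D : DworkData R p e q g N P) : 0 < e :=
  Nat.pos_of_ne_zero fun he => absurd D.one_lt (by simp [he])

theorem isUnit_det (D : DworkData R p e q g N P) (hk : 0 < k) :
    IsUnit (masterMatrix (p ^ e) g N P k).det := by
  set I : Ideal R := Ideal.span {(p : R)}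
  have hlocal : IsLocalHom (Ideal.Quotient.mk I) :=
    isLocalHom_of_le_jacobson_bot I
      ((Ideal.span_singleton_le_iff_mem _).2 D.mem_jacobson)
  refine isUnit_of_map_unit (Ideal.Quotient.mk I) _ ?_
  obtain hsub | hnon := subsingleton_or_nontrivial (R ⧸ I)
  · exact isUnit_of_subsingleton _
  have hp0 : ((p : ℕ) : R ⧸ I) = 0 := by
    rw [← map_natCast (Ideal.Quotient.mk I), Ideal.Quotient.eq_zero_iff_mem]
    exact Ideal.mem_span_singleton_self _
  have hchar : CharP (R ⧸ I) p := (CharP.charP_iff_prime_eq_zero D.prime).2 hp0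
  have hexp : ExpChar (R ⧸ I) p := ExpChar.prime D.prime
  have hmap : ∀ j, Ideal.Quotient.mk I (masterMatrix (p ^ e) g N P j).det
      = (masterMatrix (p ^ e) g N (P.map (Ideal.Quotient.mk I)) j).det := fun j => by
    rw [masterMatrix_map, RingHom.map_det, RingHom.mapMatrix_apply]
  rw [hmap]
  exact isUnit_det_masterMatrix_of_expChar D.toExponentData (natDegree_map_le.trans D.natDegree_le)
    (hmap 1 ▸ D.isUnit_det_one.map _) hk

/-- The functionals determined modulo `p ^ m`, on polynomials of degree at most `g q + g`, by their
values on the test polynomials, with the normalized functionals of level `k` as dual family. -/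
def determinedAt (p e q g : ℕ) (N : ℕ → ℕ) (P : R[X]) (k m : ℕ) : Submodule R (R[X] →ₗ[R] R) :=
  determinedBy (degreeLE R (g * q + g : ℕ)) (Ideal.span {(p : R) ^ m}) (testPoly g P)
    (normalizedFun (p ^ e) g N P k)

theorem coeffMul_mem_determinedAt_self (D : DworkData R p e q g N P) (hk : 0 < k) (m v : ℕ) :
    coeffMul (X * P ^ (N k - 1)) (v * (p ^ e) ^ k) ∈ determinedAt p e q g N P k m := by
  by_cases hv : v = 0 ∨ g < v
  · refine mem_determinedBy_of_forall_mem (testPoly_mem_degreeLE D.natDegree_le) fun f hf => ?_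
    rw [coeffMul_eq_zero D.toExponentData hk D.natDegree_le hf hv]
    exact zero_mem _
  · have hself := self_mem_determinedBy (W := degreeLE R (g * q + g : ℕ))
      (I := Ideal.span {(p : R) ^ m}) (D.isUnit_det hk) ⟨v - 1, by omega⟩
    rwa [masterFun, Nat.sub_add_cancel (by omega)] at hself

theorem smul_mem_determinedAt {i m : ℕ} {x : R} {φ : R[X] →ₗ[R] R} (hx : (p : R) ^ i ∣ x)
    (hφ : φ ∈ determinedAt p e q g N P k m) : x • φ ∈ determinedAt p e q g N P k (i + m) := by
  rw [determinedAt, pow_add, ← Ideal.span_singleton_mul_span_singleton]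
  exact smul_mem_determinedBy (Ideal.mem_span_singleton.2 hx) hφ

theorem mem_determinedAt_zero (φ : R[X] →ₗ[R] R) : φ ∈ determinedAt p e q g N P k 0 :=
  fun f _ => by simp

theorem mul_pow_sub_one (D : DworkData R p e q g N P) {j : ℕ} (hj : 0 < j) (hjk : j ≤ k) :
    P ^ (N k - 1) = P ^ (N j - 1) * (P ^ N (k - j)) ^ (p ^ e) ^ j := by
  rw [← pow_mul, ← pow_add, ← D.sub_one_add hj, Nat.add_sub_cancel' hjk]

-- Expanding `H ^ (Q ^ k)`, the coefficient of `t ^ b` is divisible by `p ^ (k - j)` for some `j`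
-- with `Q ^ j ∣ b`. It multiplies a functional of level `j`, to which the induction applies modulo
-- `p ^ j`.
theorem coeffMul_mem_determinedAt (D : DworkData R p e q g N P) (k : ℕ) (hk : 0 < k) (H : R[X])
    (l : ℕ) :
    coeffMul (X * P ^ (N k - 1) * H ^ (p ^ e) ^ k) (l * (p ^ e) ^ k)
      ∈ determinedAt p e q g N P k k := by
  induction k using Nat.strong_induction_on generalizing H l with
  | _ k ih =>
  have hlevel : ∀ j ≤ k, ∀ v, coeffMul (X * P ^ (N k - 1)) (v * (p ^ e) ^ j)
      ∈ determinedAt p e q g N P k j := by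
    intro j hjk v
    obtain rfl | hj := Nat.eq_zero_or_pos j
    · exact mem_determinedAt_zero _
    obtain rfl | hjk := hjk.eq_or_lt
    · exact D.coeffMul_mem_determinedAt_self hk j v
    have hj_level : ∀ v, coeffMul (X * P ^ (N k - 1)) (v * (p ^ e) ^ j)
        ∈ determinedAt p e q g N P j j := fun v => by
      rw [D.mul_pow_sub_one hj hjk.le, ← mul_assoc]
      exact ih j hjk hj _ _
    refine determinedBy_le_dualFamily (D.isUnit_det hk) (fun v => ?_) (hj_level v)
    rw [masterFun, ← Nat.sub_add_cancel hjk.le, pow_add, ← mul_assoc, Nat.sub_add_cancel hjk.le]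
    exact hj_level _
  rw [coeffMul_mul]
  refine Submodule.sum_mem _ fun ⟨a, b⟩ hab => ?_
  rw [HasAntidiagonal.mem_antidiagonal] at hab
  obtain ⟨j, hjk, hjb, hcoeff⟩ :=
    exists_pow_dvd_coeff_pow D.prime D.mem_nonZeroDivisors D.e_pos k H b
  obtain ⟨v, rfl⟩ : (p ^ e) ^ j ∣ a :=
    (Nat.dvd_add_left hjb).1 (hab ▸ dvd_mul_of_dvd_right (pow_dvd_pow _ hjk) l)
  have := smul_mem_determinedAt hcoeff (hlevel j hjk v)
  rwa [Nat.sub_add_cancel hjk, mul_comm v] at this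

theorem pow_dvd_normalizedFun_succ_sub (D : DworkData R p e q g N P) (k : ℕ) (l : Fin g) {f : R[X]}
    (hf : f ∈ degreeLE R (g * q + g : ℕ)) :
    (p : R) ^ k ∣
      normalizedFun (p ^ e) g N P (k + 1) l f - normalizedFun (p ^ e) g N P k l f := by
  obtain rfl | hk := Nat.eq_zero_or_pos k
  · simp
  rw [← Ideal.mem_span_singleton]
  refine dualFamily_sub_mem (D.isUnit_det k.succ_pos) (fun v => ?_) l hf
  rw [masterFun, D.mul_pow_sub_one hk k.le_succ, pow_succ', ← mul_assoc, ← mul_assoc]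
  exact D.coeffMul_mem_determinedAt k hk _ _

end DworkData

section ExactForms

variable {R : Type*} [CommRing R] {Q q g : ℕ} {N : ℕ → ℕ} {k : ℕ}

/-- The polynomial `q P f' - P' f`. Its product with `P ^ (N k - 1)` is the derivative of
`q P ^ N k f` up to a multiple of `Q ^ k`, as `q N k ≡ -1`. -/
def exactForm (q : ℕ) (P f : R[X]) : R[X] :=
  (q : R[X]) * P * derivative f - derivative P * f

theorem pow_dvd_masterFun_exactForm (h : ExponentData Q q g N) (hk : 0 < k) (P f : R[X])
    (v : Fin g) : (Q : R) ^ k ∣ masterFun Q g N P k v (exactForm q P f) := by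
  obtain ⟨M, hM⟩ : ∃ M, N k = M + 1 := Nat.exists_eq_succ_of_ne_zero (h.pos hk).ne'
  have hQ : (Q : R[X]) ^ k = (M + 1) * q + 1 := by
    exact_mod_cast congrArg (Nat.cast (R := R[X])) (hM ▸ h.mul_add_one k).symm
  have hpoly : X * P ^ (N k - 1) * exactForm q P f
      = (q : R[X]) * (X * derivative (P ^ N k * f))
        - (Q : R[X]) ^ k * (X * P ^ M * derivative P * f) := by
    rw [hQ, hM, Nat.add_sub_cancel, exactForm, derivative_mul, derivative_pow_succ, C_add,
      C_eq_natCast, C_1]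
    ring
  obtain ⟨i, hi⟩ : ∃ i, ((v : ℕ) + 1) * Q ^ k = i + 1 :=
    Nat.exists_eq_succ_of_ne_zero (Nat.mul_pos v.1.succ_pos (h.pow_pos k)).ne'
  have hdvd : (Q : R) ^ k ∣ (i : R) + 1 := by
    rw [← Nat.cast_succ, Nat.succ_eq_add_one, ← hi]
    exact ⟨((v : ℕ) + 1 : ℕ), by push_cast; ring⟩
  rw [masterFun, coeffMul_apply, hpoly, hi, coeff_sub, ← C_eq_natCast, ← C_eq_natCast, ← C_pow,
    coeff_C_mul, coeff_C_mul, coeff_X_mul, coeff_derivative]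
  exact dvd_sub (((hdvd.mul_left _)).mul_left _) (dvd_mul_right _ _)

theorem pow_dvd_normalizedFun_exactForm (h : ExponentData Q q g N) (hk : 0 < k) (P f : R[X])
    (l : Fin g) : (Q : R) ^ k ∣ normalizedFun Q g N P k l (exactForm q P f) := by
  rw [normalizedFun_eq_sum]
  exact Finset.dvd_sum fun v _ => (pow_dvd_masterFun_exactForm h hk P f v).mul_right _

end ExactForms

section AnalyticSeries

variable {K σ : Type*} [NontriviallyNormedField K]

theorem exists_forall_prod_apply_eq {k : ℕ} {α : σ →₀ ℕ} (hα : α.degree = k) :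
    ∃ t : Fin k → σ, ∀ y : σ → K, ∏ j, y (t j) = α.prod fun i d => y i ^ d := by
  obtain ⟨l, hl⟩ : ∃ l : List σ, (l : Multiset σ) = Finsupp.toMultiset α :=
    ⟨_, Multiset.coe_toList _⟩
  obtain rfl : l.length = k := by
    rw [← hα, ← Multiset.coe_card, hl, Finsupp.card_toMultiset]
    rfl
  refine ⟨l.get, fun y => ?_⟩
  calc ∏ j, y (l.get j) = (Multiset.map y l).prod := by
        rw [Multiset.map_coe, Multiset.prod_coe, ← List.prod_ofFn]
        exact congrArg List.prod (List.ext_get (by simp) (by simp))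
    _ = α.prod fun i d => y i ^ d := by
        rw [hl, Finsupp.toMultiset_map, Finsupp.prod_toMultiset,
          Finsupp.prod_mapDomain_index (by simp) (by simp [pow_add])]

variable [Fintype σ]

theorem exists_multilinear_eq_monomial {k : ℕ} {α : σ →₀ ℕ} (hα : α.degree = k) :
    ∃ M : ContinuousMultilinearMap K (fun _ : Fin k => σ → K) K, ‖M‖ ≤ 1 ∧
      ∀ y : σ → K, M (fun _ => y) = α.prod fun i d => y i ^ d := by
  obtain ⟨t, ht⟩ := exists_forall_prod_apply_eq (K := K) hα
  refine ⟨(ContinuousMultilinearMap.mkPiAlgebra K (Fin k) K).compContinuousLinearMap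
    fun j => ContinuousLinearMap.proj (t j), ?_, fun y => by simpa using ht y⟩
  refine ContinuousMultilinearMap.opNorm_le_bound zero_le_one fun y => ?_
  simpa [norm_prod] using
    Finset.prod_le_prod (fun _ _ => norm_nonneg _) fun j _ => norm_le_pi_norm (y j) (t j)

theorem exists_hasFPowerSeriesOnBall_of_hasSum [IsUltrametricDist K] {c : (σ →₀ ℕ) → K}
    (hc : ∀ α, ‖c α‖ ≤ 1) {f : (σ → K) → K} {a : σ → K}
    (h : ∀ y : σ → K, ‖y‖ < 1 → HasSum (fun α => c α * α.prod fun i d => y i ^ d) (f (a + y))) :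
    ∃ S : FormalMultilinearSeries K (σ → K) K, HasFPowerSeriesOnBall f S a 1 := by
  choose M hM_norm hM using fun k (α : {α : σ →₀ ℕ // α.degree = k}) =>
    exists_multilinear_eq_monomial (K := K) α.2
  have hfinite (k : ℕ) : Finite {α : σ →₀ ℕ // α.degree = k} :=
    (Finsupp.finite_of_degree_le k).subset fun α hα => le_of_eq hα
  have hfintype (k : ℕ) : Fintype {α : σ →₀ ℕ // α.degree = k} := Fintype.ofFinite _
  let S : FormalMultilinearSeries K (σ → K) K := fun k => ∑ α, c α.1 • M k α
  have hS_norm (k : ℕ) : ‖S k‖ ≤ 1 := by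
    refine ContinuousMultilinearMap.opNorm_le_bound zero_le_one fun y => ?_
    rw [one_mul, _root_.sum_apply]
    refine IsUltrametricDist.norm_sum_le_of_forall_le_of_nonneg
      (Finset.prod_nonneg fun _ _ => norm_nonneg _) fun α _ => ?_
    calc ‖(c α.1 • M k α) y‖ ≤ 1 * (1 * ∏ j, ‖y j‖) := by
          rw [_root_.smul_apply, norm_smul]
          exact mul_le_mul (hc α.1) ((M k α).le_of_opNorm_le (hM_norm k α) y) (norm_nonneg _)
            zero_le_one
      _ = ∏ j, ‖y j‖ := by rw [one_mul, one_mul]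
  refine ⟨S, S.le_radius_of_bound 1 fun k => by simpa using hS_norm k, one_pos, fun {y} hy => ?_⟩
  have hy_norm : ‖y‖ < 1 := by simpa [enorm_eq_nnnorm, ← NNReal.coe_lt_coe] using hy
  have hsum := h y hy_norm
  rw [← (Equiv.sigmaFiberEquiv (fun α : σ →₀ ℕ => α.degree)).hasSum_iff] at hsum
  refine hsum.sigma fun k => ?_
  have hSk : S k (fun _ => y) = ∑ α : {α : σ →₀ ℕ // α.degree = k},
      c α.1 * α.1.prod fun i d => y i ^ d := by
    simp [S, hM]
  rw [hSk]
  exact hasSum_fintype _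

end AnalyticSeries

section IntegerRing

open scoped NormedField Valued

variable {K : Type*} [NontriviallyNormedField K] [IsUltrametricDist K]

theorem dvd_iff_norm_le_norm {x y : 𝒪[K]} : x ∣ y ↔ ‖y‖ ≤ ‖x‖ := by
  rw [← Ideal.mem_span_singleton, ← SetLike.mem_coe,
    Valued.integer.coe_span_singleton_eq_closedBall, mem_closedBall_zero_iff]

instance [CompleteSpace K] : CompleteSpace 𝒪[K] :=
  (Valued.isClosed_integer K).completeSpace_coe

instance : IsLinearTopology 𝒪[K] 𝒪[K] := by
  have hbasis : (𝓝 (0 : 𝒪[K])).HasBasis (fun x : 𝒪[K] => x ≠ 0)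
      fun x => (Ideal.span {x} : Set 𝒪[K]) := by
    refine Metric.nhds_basis_closedBall.to_hasBasis (fun ε hε => ?_) fun x hx =>
      ⟨‖x‖, norm_pos_iff.2 hx, (Valued.integer.coe_span_singleton_eq_closedBall x).ge⟩
    obtain ⟨z, hz_pos, hz_lt⟩ := NormedField.exists_norm_lt K (lt_min hε one_pos)
    refine ⟨⟨z, Valued.integer.mem_iff.2 (hz_lt.trans_le (min_le_right _ _)).le⟩,
      fun h => hz_pos.ne' (by simpa using congrArg Subtype.val h), ?_⟩
    rw [Valued.integer.coe_span_singleton_eq_closedBall]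
    exact Metric.closedBall_subset_closedBall (hz_lt.trans_le (min_le_left _ _)).le
  exact IsLinearTopology.mk_of_hasBasis _ hbasis

theorem hasEval_of_norm_lt_one {σ : Type*} [Finite σ] {y : σ → 𝒪[K]} (hy : ∀ i, ‖y i‖ < 1) :
    MvPowerSeries.HasEval y where
  hpow i := tendsto_pow_atTop_nhds_zero_of_norm_lt_one (hy i)
  tendsto_zero := by simp [Filter.cofinite_eq_bot]

theorem analyticAt_of_eq_aeval [CompleteSpace K] {σ : Type*} [Fintype σ] (F : MvPowerSeries σ 𝒪[K])
    {f : (σ → K) → K} {a : σ → K}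
    (h : ∀ (y : σ → 𝒪[K]) (hy : MvPowerSeries.HasEval y),
      f (fun i => a i + y i) = (MvPowerSeries.aeval (R := 𝒪[K]) hy F : 𝒪[K])) :
    AnalyticAt K f a := by
  suffices hball : ∃ S : FormalMultilinearSeries K (σ → K) K, HasFPowerSeriesOnBall f S a 1 from
    hball.imp fun _ hS => hS.hasFPowerSeriesAt
  refine exists_hasFPowerSeriesOnBall_of_hasSum (K := K)
    (c := fun α => ((MvPowerSeries.coeff α F : 𝒪[K]) : K))
    (fun α => Valued.integer.norm_le_one _) fun y hy => ?_
  have hy_lt (i : σ) : ‖y i‖ < 1 := (norm_le_pi_norm y i).trans_lt hy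
  let y' : σ → 𝒪[K] := fun i => ⟨y i, Valued.integer.mem_iff.2 (hy_lt i).le⟩
  have hy' : MvPowerSeries.HasEval y' := hasEval_of_norm_lt_one hy_lt
  have hsum := (MvPowerSeries.hasSum_aeval (R := 𝒪[K]) hy' F).map
    (𝒪[K]).subtype.toAddMonoidHom continuous_subtype_val
  convert hsum using 1
  · funext α
    simp [Finsupp.prod, y']
  · exact h y' hy'

theorem exists_pow_dvd_sub_of_pow_dvd_succ_sub [CompleteSpace K] {π : 𝒪[K]} (hπ : ‖π‖ < 1)
    {x : ℕ → 𝒪[K]} (h : ∀ s, π ^ s ∣ x (s + 1) - x s) : ∃ L, ∀ s, π ^ s ∣ x s - L := by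
  have hdvd {s t : ℕ} (hst : s ≤ t) : π ^ s ∣ x s - x t := by
    induction t, hst using Nat.le_induction with
    | base => simp
    | succ t hst ih =>
      rw [← sub_sub_sub_cancel_right (x s) (x (t + 1)) (x t)]
      exact dvd_sub ih ((pow_dvd_pow π hst).trans (h t))
  have hcauchy : CauchySeq x := by
    refine cauchySeq_of_le_geometric ‖π‖ 1 hπ fun s => ?_
    rw [dist_eq_norm, one_mul, ← norm_pow]
    exact dvd_iff_norm_le_norm.1 (hdvd s.le_succ)
  obtain ⟨L, hL⟩ := cauchySeq_tendsto_of_complete hcauchy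
  refine ⟨L, fun s => dvd_iff_norm_le_norm.2 ?_⟩
  exact le_of_tendsto (hL.const_sub (x s)).norm
    ((eventually_ge_atTop s).mono fun t hst => dvd_iff_norm_le_norm.1 (hdvd hst))

theorem C_dvd_iff_forall_dvd_coeff {R σ : Type*} [CommRing R] {r : R} {F : MvPowerSeries σ R} :
    MvPowerSeries.C r ∣ F ↔ ∀ α, r ∣ MvPowerSeries.coeff α F := by
  refine ⟨?_, fun h => ?_⟩
  · rintro ⟨G, rfl⟩ α
    rw [MvPowerSeries.coeff_C_mul]
    exact dvd_mul_right _ _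
  · choose G hG using h
    let G' : MvPowerSeries σ R := G
    refine ⟨G', MvPowerSeries.ext fun α => ?_⟩
    rw [hG, MvPowerSeries.coeff_C_mul]
    rfl

theorem exists_C_pow_dvd_sub_of_C_pow_dvd_succ_sub [CompleteSpace K] {π : 𝒪[K]} (hπ : ‖π‖ < 1)
    {σ : Type*} {F : ℕ → MvPowerSeries σ 𝒪[K]}
    (h : ∀ s, MvPowerSeries.C π ^ s ∣ F (s + 1) - F s) :
    ∃ L, ∀ s, MvPowerSeries.C π ^ s ∣ F s - L := by
  simp only [← map_pow, C_dvd_iff_forall_dvd_coeff] at h ⊢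
  choose L hL using fun α => exists_pow_dvd_sub_of_pow_dvd_succ_sub hπ
    (x := fun s => MvPowerSeries.coeff α (F s)) fun s => by simpa using h s α
  exact ⟨(L : MvPowerSeries σ 𝒪[K]), fun s α => hL α s⟩

end IntegerRing

section Nodes

variable {R S : Type*} [CommRing R] [CommRing S]

theorem nodal_map {ι : Type*} (φ : R →+* S) (s : Finset ι) (b : ι → R) :
    (Lagrange.nodal s b).map φ = Lagrange.nodal s fun j => φ (b j) := by
  simp [Lagrange.nodal_eq, Polynomial.map_prod]

theorem map_powProd {n : ℕ} (b : Fin n → R) (N : ℕ) :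
    (powProd n N).map (MvPolynomial.aeval (R := ℤ) b).toRingHom
      = Lagrange.nodal univ b ^ N := by
  simp [powProd, Lagrange.nodal_eq, Polynomial.map_prod, Finset.prod_pow]

theorem map_powProdQuot {n N : ℕ} (hN : 0 < N) (b : Fin n → R) (i : Fin n) :
    (powProdQuot n N i).map (MvPolynomial.aeval (R := ℤ) b).toRingHom
      = Lagrange.nodal univ b ^ (N - 1) * Lagrange.nodal (univ.erase i) b := by
  obtain ⟨N, rfl⟩ : ∃ M, N = M + 1 := Nat.exists_eq_succ_of_ne_zero hN.ne'
  rw [Lagrange.nodal_eq_mul_nodal_erase (mem_univ i), mul_pow, Nat.add_sub_cancel, mul_assoc,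
    ← pow_succ]
  simp [powProdQuot, Lagrange.nodal_eq, Polynomial.map_prod, Finset.prod_pow]

variable {p q g s : ℕ}

/-- The Hasse--Witt matrix of level `s` at a point of `R ^ n`, over any commutative ring `R`. -/
def hasseWittAt (p q g : ℕ) (b : Fin (g * q + 1) → R) (s : ℕ) : Matrix (Fin g) (Fin g) R :=
  masterMatrix (p ^ ordMod p q) g (masterExp p q) (Lagrange.nodal univ b) s

/-- The functional that maps the product of the `t - b_j`, `j ≠ i`, to the `(i, l)` entry of
`I_s(b) ⬝ A(Φ_s)(b)⁻¹`. -/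
def solFun (p q g : ℕ) (b : Fin (g * q + 1) → R) (s : ℕ) (l : Fin g) : R[X] →ₗ[R] R :=
  normalizedFun (p ^ ordMod p q) g (masterExp p q) (Lagrange.nodal univ b) s l

theorem hasseWittAt_map (φ : R →+* S) (b : Fin (g * q + 1) → R) (s : ℕ) :
    hasseWittAt p q g (fun j => φ (b j)) s = (hasseWittAt p q g b s).map φ := by
  rw [hasseWittAt, ← nodal_map, masterMatrix_map, hasseWittAt]

theorem det_hasseWittAt_map (φ : R →+* S) (b : Fin (g * q + 1) → R) (s : ℕ) :
    (hasseWittAt p q g (fun j => φ (b j)) s).det = φ (hasseWittAt p q g b s).det := by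
  rw [hasseWittAt_map, RingHom.map_det, RingHom.mapMatrix_apply]

theorem solFun_map (φ : R →+* S) {b : Fin (g * q + 1) → R}
    (h : IsUnit (hasseWittAt p q g b s).det) (l : Fin g) (f : R[X]) :
    solFun p q g (fun j => φ (b j)) s l (f.map φ) = φ (solFun p q g b s l f) := by
  rw [solFun, ← nodal_map, normalizedFun_map φ h, solFun]

theorem exponentData_masterExp (hp : p.Prime) (hpq : p.Coprime q) (hq : 1 < q)
    (hg : g ≤ p ^ ordMod p q) : ExponentData (p ^ ordMod p q) q g (masterExp p q) where
  mul_add_one s := by rw [masterExp_mul hp.pos, pow_mul]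
  one_lt := by
    have : NeZero q := ⟨by omega⟩
    refine Nat.one_lt_pow ?_ hp.one_lt
    rw [ordMod, ← ZMod.coe_unitOfCoprime p hpq, orderOf_units]
    exact (orderOf_pos _).ne'
  le := hg

variable {K : Type*} [Field K]

theorem evalMatrix_hasseWitt (hE : ExponentData (p ^ ordMod p q) q g (masterExp p q))
    (hs : 0 < s) (a : Fin (g * q + 1) → K) :
    evalMatrix (hasseWitt p q g s) a = hasseWittAt p q g a s := by
  ext u v
  rw [hasseWittAt, masterMatrix_apply hE hs, ← map_powProd, coeff_map, mul_comm (v.1 + 1),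
    ← pow_mul]
  rfl

theorem evalMatrix_hypergeomSol_apply
    (hE : ExponentData (p ^ ordMod p q) q g (masterExp p q)) (hs : 0 < s)
    (a : Fin (g * q + 1) → K) (i : Fin (g * q + 1)) (l : Fin g) :
    evalMatrix (hypergeomSol p q g s) a i l
      = masterFun (p ^ ordMod p q) g (masterExp p q) (Lagrange.nodal univ a) s l
          (Lagrange.nodal (univ.erase i) a) := by
  obtain ⟨m, hm⟩ : ∃ m, ((l : ℕ) + 1) * (p ^ ordMod p q) ^ s = m + 1 :=
    Nat.exists_eq_succ_of_ne_zero (Nat.mul_pos l.1.succ_pos (hE.pow_pos s)).ne'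
  rw [masterFun, coeffMul_apply, mul_assoc, ← map_powProdQuot (hE.pos hs), hm, coeff_X_mul,
    coeff_map, ← Nat.add_sub_cancel (n := m) (m := 1), ← hm, ← pow_mul]
  rfl

theorem normalizedSol_apply (hE : ExponentData (p ^ ordMod p q) q g (masterExp p q))
    (hs : 0 < s) (a : Fin (g * q + 1) → K) (i : Fin (g * q + 1)) (l : Fin g) :
    normalizedSol p q g s a i l = solFun p q g a s l (Lagrange.nodal (univ.erase i) a) := by
  rw [normalizedSol, Matrix.mul_apply, solFun, normalizedFun_eq_sum, evalMatrix_hasseWitt hE hs]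
  simp only [evalMatrix_hypergeomSol_apply hE hs]
  rfl

end Nodes

section Limit

open scoped NormedField Valued

variable {K : Type*} [NontriviallyNormedField K] [IsUltrametricDist K] {p q g s : ℕ}

/-- The formal neighbourhood of the point `b`. -/
def formalNodes {R σ : Type*} [CommRing R] (b : σ → R) (j : σ) : MvPowerSeries σ R :=
  MvPowerSeries.C (b j) + MvPowerSeries.X j

theorem aeval_formalNodes [CompleteSpace K] {σ : Type*} (b : σ → 𝒪[K])
    {y : σ → 𝒪[K]} (hy : MvPowerSeries.HasEval y) (j : σ) :
    (MvPowerSeries.aeval (R := 𝒪[K]) hy).toRingHom (formalNodes b j) = b j + y j := by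
  have hC : MvPowerSeries.aeval (R := 𝒪[K]) hy (MvPowerSeries.C (b j)) = b j :=
    (MvPowerSeries.aeval (R := 𝒪[K]) hy).commutes (b j)
  have hX : MvPowerSeries.aeval (R := 𝒪[K]) hy (MvPowerSeries.X j) = y j := by
    rw [← MvPolynomial.coe_X, MvPowerSeries.aeval_coe, MvPolynomial.aeval_X]
  simp [formalNodes, hC, hX]

theorem constantCoeff_formalNodes {R σ : Type*} [CommRing R] (b : σ → R) (j : σ) :
    MvPowerSeries.constantCoeff (formalNodes b j) = b j := by
  simp [formalNodes]

theorem constantCoeff_det_hasseWittAt_formalNodes {R : Type*} [CommRing R]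
    (b : Fin (g * q + 1) → R) (s : ℕ) :
    MvPowerSeries.constantCoeff (hasseWittAt p q g (formalNodes b) s).det
      = (hasseWittAt p q g b s).det := by
  rw [← det_hasseWittAt_map]
  simp only [constantCoeff_formalNodes]

theorem dworkData_formalNodes [CharZero K] (hpr : p.Prime) (hp : ‖(p : K)‖ < 1)
    (hE : ExponentData (p ^ ordMod p q) q g (masterExp p q)) {b : Fin (g * q + 1) → 𝒪[K]}
    (hb : IsUnit (hasseWittAt p q g b 1).det) :
    DworkData (MvPowerSeries (Fin (g * q + 1)) 𝒪[K]) p (ordMod p q) q g (masterExp p q)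
      (Lagrange.nodal univ (formalNodes b)) where
  toExponentData := hE
  prime := hpr
  mem_nonZeroDivisors := by
    refine mem_nonZeroDivisors_of_ne_zero fun h => Nat.cast_ne_zero (R := K).2 hpr.ne_zero ?_
    simpa using congrArg (fun F => ((MvPowerSeries.constantCoeff F : 𝒪[K]) : K)) h
  mem_jacobson := by
    rw [IsLocalRing.jacobson_eq_maximalIdeal ⊥ bot_ne_top, IsLocalRing.mem_maximalIdeal,
      mem_nonunits_iff, MvPowerSeries.isUnit_iff_constantCoeff, map_natCast,
      Valued.integer.isUnit_iff_norm_eq_one]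
    exact hp.ne
  natDegree_le := by simp [Lagrange.natDegree_nodal]
  isUnit_det_one := by
    rw [MvPowerSeries.isUnit_iff_constantCoeff]
    exact (constantCoeff_det_hasseWittAt_formalNodes b 1).symm ▸ hb

theorem isUnit_det_hasseWittAt [CharZero K] (hpr : p.Prime) (hp : ‖(p : K)‖ < 1)
    (hE : ExponentData (p ^ ordMod p q) q g (masterExp p q)) {b : Fin (g * q + 1) → 𝒪[K]}
    (hb : IsUnit (hasseWittAt p q g b 1).det) (hs : 0 < s) :
    IsUnit (hasseWittAt p q g b s).det := by
  have hformal : IsUnit (hasseWittAt p q g (formalNodes b) s).det :=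
    (dworkData_formalNodes hpr hp hE hb).isUnit_det hs
  rw [← constantCoeff_det_hasseWittAt_formalNodes]
  exact hformal.map MvPowerSeries.constantCoeff

theorem exists_integral_of_mem_kzDomain
    (hE : ExponentData (p ^ ordMod p q) q g (masterExp p q)) {a : Fin (g * q + 1) → K}
    (ha : a ∈ kzDomain p q g K) :
    ∃ b : Fin (g * q + 1) → 𝒪[K], (fun j => (b j : K)) = a ∧
      IsUnit (hasseWittAt p q g b 1).det := by
  obtain ⟨ha_norm, hdet⟩ := ha
  lift a to Fin (g * q + 1) → 𝒪[K] using fun j => Valued.integer.mem_iff.2 (ha_norm j)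
  refine ⟨a, rfl, Valued.integer.isUnit_iff_norm_eq_one.2 ?_⟩
  rw [evalMatrix_hasseWitt hE one_pos] at hdet
  exact (congrArg norm (det_hasseWittAt_map (𝒪[K]).subtype a 1)).symm.trans hdet

theorem normalizedSol_coe (hE : ExponentData (p ^ ordMod p q) q g (masterExp p q)) (hs : 0 < s)
    {b : Fin (g * q + 1) → 𝒪[K]} (hb : IsUnit (hasseWittAt p q g b s).det)
    (i : Fin (g * q + 1)) (l : Fin g) :
    normalizedSol p q g s (fun j => (b j : K)) i l
      = (solFun p q g b s l (Lagrange.nodal (univ.erase i) b) : 𝒪[K]) := by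
  rw [normalizedSol_apply hE hs]
  exact (congrArg _ (nodal_map (𝒪[K]).subtype _ b).symm).trans
    (solFun_map (𝒪[K]).subtype hb l _)

theorem norm_le_of_natCast_pow_dvd {x : 𝒪[K]} (h : (p : 𝒪[K]) ^ s ∣ x) :
    ‖(x : K)‖ ≤ ‖(p : K)‖ ^ s := by
  simpa using dvd_iff_norm_le_norm.1 h

theorem limitSol_eq_of_norm_sub_le (hp : ‖(p : K)‖ < 1) {a : Fin (g * q + 1) → K}
    {i : Fin (g * q + 1)} {l : Fin g} {L : K}
    (h : ∀ s, 0 < s → ‖normalizedSol p q g s a i l - L‖ ≤ ‖(p : K)‖ ^ s) :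
    limitSol p q g a i l = L := by
  refine Tendsto.limUnder_eq (tendsto_iff_norm_sub_tendsto_zero.2 ?_)
  exact squeeze_zero' (Eventually.of_forall fun _ => norm_nonneg _)
    ((eventually_gt_atTop 0).mono h) (tendsto_pow_atTop_nhds_zero_of_lt_one (norm_nonneg _) hp)

variable [CharZero K]

theorem norm_det_hasseWitt (hpr : p.Prime) (hp : ‖(p : K)‖ < 1)
    (hE : ExponentData (p ^ ordMod p q) q g (masterExp p q)) {a : Fin (g * q + 1) → K}
    (ha : a ∈ kzDomain p q g K) (hs : 0 < s) :
    ‖(evalMatrix (hasseWitt p q g s) a).det‖ = 1 := by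
  obtain ⟨b, rfl, hb⟩ := exists_integral_of_mem_kzDomain hE ha
  rw [evalMatrix_hasseWitt hE hs,
    ← Valued.integer.isUnit_iff_norm_eq_one.1 (isUnit_det_hasseWittAt hpr hp hE hb hs)]
  exact congrArg norm (det_hasseWittAt_map (𝒪[K]).subtype b s)

variable [CompleteSpace K]

-- The Dwork congruences hold over the formal neighbourhood of `b`, so the limit is a power series.
theorem exists_series_norm_normalizedSol_sub_le (hpr : p.Prime) (hp : ‖(p : K)‖ < 1)
    (hE : ExponentData (p ^ ordMod p q) q g (masterExp p q)) {b : Fin (g * q + 1) → 𝒪[K]}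
    (hb : IsUnit (hasseWittAt p q g b 1).det) (i : Fin (g * q + 1)) (l : Fin g) :
    ∃ F : MvPowerSeries (Fin (g * q + 1)) 𝒪[K],
      ∀ (y : Fin (g * q + 1) → 𝒪[K]) (hy : MvPowerSeries.HasEval y) (s : ℕ), 0 < s →
        ‖normalizedSol p q g s (fun j => (b j : K) + y j) i l
          - (MvPowerSeries.aeval (R := 𝒪[K]) hy F : 𝒪[K])‖ ≤ ‖(p : K)‖ ^ s := by
  have D := dworkData_formalNodes hpr hp hE hb
  have hdegree : Lagrange.nodal (univ.erase i) (formalNodes b) ∈ degreeLE _ (g * q + g : ℕ) := by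
    rw [mem_degreeLE, ← natDegree_le_iff_degree_le]
    simp [Lagrange.natDegree_nodal]
  obtain ⟨F, hF⟩ := exists_C_pow_dvd_sub_of_C_pow_dvd_succ_sub (π := (p : 𝒪[K]))
    (by simpa using hp)
    (F := fun s => solFun p q g (formalNodes b) s l (Lagrange.nodal (univ.erase i) (formalNodes b)))
    fun s => by
      rw [map_natCast]
      exact D.pow_dvd_normalizedFun_succ_sub s l hdegree
  refine ⟨F, fun y hy s hs => ?_⟩
  set φ := (MvPowerSeries.aeval (R := 𝒪[K]) hy).toRingHom
  have hnodes : (fun j => φ (formalNodes b j)) = fun j => b j + y j :=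
    funext fun j => aeval_formalNodes b hy j
  have hformal : IsUnit (hasseWittAt p q g (formalNodes b) s).det := D.isUnit_det hs
  have hunit : IsUnit (hasseWittAt p q g (fun j => b j + y j) s).det := by
    rw [← hnodes, det_hasseWittAt_map]
    exact hformal.map φ
  have hvalue : normalizedSol p q g s (fun j => (b j : K) + y j) i l
      = φ (solFun p q g (formalNodes b) s l (Lagrange.nodal (univ.erase i) (formalNodes b))) := by
    rw [← solFun_map φ hformal, nodal_map, hnodes]
    exact normalizedSol_coe hE hs hunit i l
  have hdvd := map_dvd φ (hF s)
  rw [map_sub, map_natCast, map_pow, map_natCast] at hdvd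
  rw [hvalue]
  exact norm_le_of_natCast_pow_dvd hdvd

theorem norm_normalizedSol_sub_limitSol_le (hpr : p.Prime) (hp : ‖(p : K)‖ < 1)
    (hE : ExponentData (p ^ ordMod p q) q g (masterExp p q)) {a : Fin (g * q + 1) → K}
    (ha : a ∈ kzDomain p q g K) (hs : 0 < s) (i : Fin (g * q + 1)) (l : Fin g) :
    ‖normalizedSol p q g s a i l - limitSol p q g a i l‖ ≤ ‖(p : K)‖ ^ s := by
  obtain ⟨b, rfl, hb⟩ := exists_integral_of_mem_kzDomain hE ha
  obtain ⟨F, hF⟩ := exists_series_norm_normalizedSol_sub_le hpr hp hE hb i l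
  have hlim := hF 0 (hasEval_of_norm_lt_one fun _ => by simp)
  simp only [Pi.zero_apply, ZeroMemClass.coe_zero, add_zero] at hlim
  rw [limitSol_eq_of_norm_sub_le hp hlim]
  exact hlim s hs

theorem tendstoUniformlyOn_normalizedSol (hpr : p.Prime) (hp : ‖(p : K)‖ < 1)
    (hE : ExponentData (p ^ ordMod p q) q g (masterExp p q)) (i : Fin (g * q + 1)) (l : Fin g) :
    TendstoUniformlyOn (fun s (a : Fin (g * q + 1) → K) => normalizedSol p q g s a i l)
      (fun a => limitSol p q g a i l) atTop (kzDomain p q g K) := by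
  rw [Metric.tendstoUniformlyOn_iff]
  intro ε hε
  filter_upwards [eventually_gt_atTop 0,
    (tendsto_pow_atTop_nhds_zero_of_lt_one (norm_nonneg _) hp).eventually_lt_const hε]
    with s hs hsε a ha
  rw [dist_comm, dist_eq_norm]
  exact (norm_normalizedSol_sub_limitSol_le hpr hp hE ha hs i l).trans_lt hsε

theorem analyticAt_limitSol (hpr : p.Prime) (hp : ‖(p : K)‖ < 1)
    (hE : ExponentData (p ^ ordMod p q) q g (masterExp p q)) {a : Fin (g * q + 1) → K}
    (ha : a ∈ kzDomain p q g K) (i : Fin (g * q + 1)) (l : Fin g) :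
    AnalyticAt K (fun x => limitSol p q g x i l) a := by
  obtain ⟨b, rfl, hb⟩ := exists_integral_of_mem_kzDomain hE ha
  obtain ⟨F, hF⟩ := exists_series_norm_normalizedSol_sub_le hpr hp hE hb i l
  exact analyticAt_of_eq_aeval F fun y hy => limitSol_eq_of_norm_sub_le hp (hF y hy)

end Limit

section Span

variable {F : Type*} [Field F] {n : ℕ} {a : Fin n → F} {V : Submodule F F[X]}

theorem mem_of_degree_lt_of_nodal_erase_mem (ha : Function.Injective a)
    (hV : ∀ i, Lagrange.nodal (univ.erase i) a ∈ V) {f : F[X]} (hf : f.degree < n) : f ∈ V := by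
  rw [Lagrange.eq_interpolate (s := univ) (v := a) ha.injOn (f := f) (by simpa using hf),
    Lagrange.interpolate_eq_sum]
  refine V.sum_mem fun i _ => ?_
  rw [← smul_eq_C_mul, ← Lagrange.nodal_eq]
  exact V.smul_mem _ (hV i)

theorem coeff_X_mul_derivative {R : Type*} [CommRing R] (P : R[X]) (m : ℕ) :
    (X * derivative P).coeff m = m * P.coeff m := by
  cases m with
  | zero => simp
  | succ m => rw [coeff_X_mul, coeff_derivative, mul_comm, Nat.cast_succ]

theorem coeff_exactForm_X_pow {R : Type*} [CommRing R] (q k : ℕ) (P : R[X]) (m : ℕ) :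
    (exactForm q P (X ^ (k + 1))).coeff (m + k) = (q * (k + 1) - m) * P.coeff m := by
  have hfactor : exactForm q P (X ^ (k + 1))
      = (C ((q : R) * (k + 1)) * P - X * derivative P) * X ^ k := by
    simp only [exactForm, derivative_X_pow, Nat.add_sub_cancel, Nat.cast_add, Nat.cast_one, C_add,
      C_mul, C_eq_natCast, C_1]
    ring
  rw [hfactor, coeff_mul_X_pow, coeff_sub, coeff_C_mul, coeff_X_mul_derivative, sub_mul]

-- The exact form of `t ^ (k + 1)` has leading term `(q (k + 1) - deg P) t ^ (deg P + k)`, so it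
-- reduces the degree of any polynomial of degree `deg P + k`.
theorem mem_of_exactForm_mem [CharZero F] {P : F[X]} (hP : P.Monic) {q : ℕ}
    (hq : ¬ q ∣ P.natDegree) (hlow : ∀ f : F[X], f.degree < P.natDegree → f ∈ V)
    (hexact : ∀ k, exactForm q P (X ^ (k + 1)) ∈ V) (f : F[X]) : f ∈ V := by
  suffices hdescent : ∀ k, ∀ f : F[X], f.degree < (P.natDegree + k : ℕ) → f ∈ V by
    refine hdescent (f.natDegree + 1) f (degree_le_natDegree.trans_lt ?_)
    exact_mod_cast (by omega : f.natDegree < P.natDegree + (f.natDegree + 1))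
  intro k
  induction k with
  | zero => exact hlow
  | succ k ih =>
    intro f hf
    set D := exactForm q P (X ^ (k + 1)) with hD
    set c := f.coeff (P.natDegree + k) / D.coeff (P.natDegree + k)
    have hlead : D.coeff (P.natDegree + k) ≠ 0 := by
      rw [hD, coeff_exactForm_X_pow, hP.coeff_natDegree, mul_one, sub_ne_zero]
      exact fun h => hq ⟨k + 1, by exact_mod_cast h.symm⟩
    have hreduced : f - c • D ∈ V := by
      refine ih _ ((degree_lt_iff_coeff_zero _ _).2 fun m hm => ?_)
      rw [coeff_sub, coeff_smul, smul_eq_mul]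
      obtain rfl | hm := hm.eq_or_lt
      · rw [div_mul_cancel₀ _ hlead, sub_self]
      · obtain ⟨m, rfl⟩ : ∃ j, m = j + k := Nat.exists_eq_add_of_le' (by omega)
        rw [(degree_lt_iff_coeff_zero _ _).1 hf _ hm, hD, coeff_exactForm_X_pow,
          coeff_eq_zero_of_natDegree_lt (by omega), mul_zero, mul_zero, sub_zero]
    exact (V.sub_mem_iff_left (V.smul_mem c (hexact k))).1 hreduced

theorem mem_of_nodal_erase_mem_of_exactForm_mem [CharZero F] (ha : Function.Injective a) {q : ℕ}
    (hq : ¬ q ∣ n) (hnodal : ∀ i, Lagrange.nodal (univ.erase i) a ∈ V)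
    (hexact : ∀ k, exactForm q (Lagrange.nodal univ a) (X ^ (k + 1)) ∈ V) (f : F[X]) : f ∈ V := by
  have hdegree : (Lagrange.nodal univ a).natDegree = n := by simp [Lagrange.natDegree_nodal]
  refine mem_of_exactForm_mem Lagrange.nodal_monic (by rwa [hdegree]) (fun f hf => ?_) hexact f
  exact mem_of_degree_lt_of_nodal_erase_mem ha hnodal (hdegree ▸ hf)

end Span

section Fiber

open scoped NormedField Valued

variable {K : Type*} [NontriviallyNormedField K] [IsUltrametricDist K] [CharZero K]
  {p q g s : ℕ} {a : Fin (g * q + 1) → K}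

theorem norm_solFun_exactForm_X_pow_le (hpr : p.Prime) (hp : ‖(p : K)‖ < 1)
    (hE : ExponentData (p ^ ordMod p q) q g (masterExp p q)) (ha : a ∈ kzDomain p q g K)
    (hs : 0 < s) (k : ℕ) (l : Fin g) :
    ‖solFun p q g a s l (exactForm q (Lagrange.nodal univ a) (X ^ k))‖ ≤ ‖(p : K)‖ ^ s := by
  obtain ⟨b, rfl, hb⟩ := exists_integral_of_mem_kzDomain hE ha
  have he : ordMod p q ≠ 0 := fun he => absurd hE.one_lt (by simp [he])
  have hdvd : (p : 𝒪[K]) ^ s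
      ∣ solFun p q g b s l (exactForm q (Lagrange.nodal univ b) (X ^ k)) := by
    refine dvd_trans (pow_dvd_pow_of_dvd ?_ s) (pow_dvd_normalizedFun_exactForm hE hs _ _ l)
    exact_mod_cast dvd_pow_self (p : 𝒪[K]) he
  have hmap : (exactForm q (Lagrange.nodal univ b) (X ^ k)).map (𝒪[K]).subtype
      = exactForm q (Lagrange.nodal univ fun j => (b j : K)) (X ^ k) := by
    simp only [exactForm, Polynomial.map_sub, Polynomial.map_mul, Polynomial.map_natCast,
      ← derivative_map, Polynomial.map_pow, map_X, nodal_map, Subring.subtype_apply]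
  rw [← hmap]
  refine le_of_eq_of_le (congrArg norm ?_) (norm_le_of_natCast_pow_dvd hdvd)
  exact solFun_map (𝒪[K]).subtype (isUnit_det_hasseWittAt hpr hp hE hb hs) l _

theorem tendsto_solFun_exactForm_X_pow (hpr : p.Prime) (hp : ‖(p : K)‖ < 1)
    (hE : ExponentData (p ^ ordMod p q) q g (masterExp p q)) (ha : a ∈ kzDomain p q g K)
    (k : ℕ) (l : Fin g) :
    Tendsto (fun s => solFun p q g a s l (exactForm q (Lagrange.nodal univ a) (X ^ k))) atTop
      (𝓝 0) :=
  squeeze_zero_norm'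
    ((eventually_gt_atTop 0).mono fun _ hs => norm_solFun_exactForm_X_pow_le hpr hp hE ha hs k l)
    (tendsto_pow_atTop_nhds_zero_of_lt_one (norm_nonneg _) hp)

theorem solFun_testPoly (hpr : p.Prime) (hp : ‖(p : K)‖ < 1)
    (hE : ExponentData (p ^ ordMod p q) q g (masterExp p q)) (ha : a ∈ kzDomain p q g K)
    (hs : 0 < s) (l u : Fin g) :
    solFun p q g a s l (testPoly g (Lagrange.nodal univ a) u) = (1 : Matrix _ _ K) u l := by
  refine normalizedFun_testPoly (isUnit_iff_ne_zero.2 (norm_ne_zero_iff.1 ?_)) l u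
  rw [← hasseWittAt, ← evalMatrix_hasseWitt hE hs, norm_det_hasseWitt hpr hp hE ha hs]
  exact one_ne_zero

variable [CompleteSpace K]

theorem tendsto_solFun_nodal_erase (hpr : p.Prime) (hp : ‖(p : K)‖ < 1)
    (hE : ExponentData (p ^ ordMod p q) q g (masterExp p q)) (ha : a ∈ kzDomain p q g K)
    (i : Fin (g * q + 1)) (l : Fin g) :
    Tendsto (fun s => solFun p q g a s l (Lagrange.nodal (univ.erase i) a)) atTop
      (𝓝 (limitSol p q g a i l)) :=
  ((tendstoUniformlyOn_normalizedSol hpr hp hE i l).tendsto_at ha).congr'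
    ((eventually_gt_atTop 0).mono fun _ hs => normalizedSol_apply hE hs a i l)

theorem sum_limitSol (hpr : p.Prime) (hp : ‖(p : K)‖ < 1)
    (hE : ExponentData (p ^ ordMod p q) q g (masterExp p q)) (ha : a ∈ kzDomain p q g K)
    (l : Fin g) : ∑ i, limitSol p q g a i l = 0 := by
  have hderiv : exactForm q (Lagrange.nodal univ a) (X ^ 0)
      = -∑ i, Lagrange.nodal (univ.erase i) a := by
    simp [exactForm, Lagrange.derivative_nodal]
  have hzero := tendsto_solFun_exactForm_X_pow hpr hp hE ha 0 l
  simp only [hderiv, map_neg, map_sum] at hzero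
  refine neg_eq_zero.1 (tendsto_nhds_unique ?_ hzero)
  exact (tendsto_finsetSum _ fun i _ => tendsto_solFun_nodal_erase hpr hp hE ha i l).neg

theorem fiberL_le_sumZero (hpr : p.Prime) (hp : ‖(p : K)‖ < 1)
    (hE : ExponentData (p ^ ordMod p q) q g (masterExp p q)) (ha : a ∈ kzDomain p q g K) :
    fiberL p q g a ≤ sumZero (g * q + 1) K := by
  rw [fiberL, Submodule.span_le]
  rintro _ ⟨l, rfl⟩
  exact sum_limitSol hpr hp hE ha l

-- A relation between the columns makes a combination of the `solFun` tend to zero on all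
-- polynomials, while its value on a test polynomial is one of the coefficients.
theorem linearIndependent_col_limitSol (hpr : p.Prime) (hp : ‖(p : K)‖ < 1)
    (hE : ExponentData (p ^ ordMod p q) q g (masterExp p q)) (hq : 1 < q)
    (ha : a ∈ kzDomainOff p q g K) : LinearIndependent K (limitSol p q g a).col := by
  obtain ⟨ha, hne⟩ := ha
  have hinj : Function.Injective a := fun i j => not_imp_not.1 (hne i j)
  rw [Fintype.linearIndependent_iff]
  intro c hc u
  set P := Lagrange.nodal univ a
  let V : Submodule K K[X] := (zeroAtFilterSubmodule K atTop).comap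
    (LinearMap.pi fun s => ∑ l, c l • solFun p q g a s l)
  have mem_V {f : K[X]} :
      f ∈ V ↔ Tendsto (fun s => ∑ l, c l * solFun p q g a s l f) atTop (𝓝 0) := by
    simp [V, zeroAtFilterSubmodule, ZeroAtFilter, LinearMap.pi]
  have hnodal : ∀ i, Lagrange.nodal (univ.erase i) a ∈ V := fun i => by
    have hrel : ∑ l, c l * limitSol p q g a i l = 0 := by
      simpa using congrFun hc i
    rw [mem_V, ← hrel]
    exact tendsto_finsetSum _ fun l _ =>
      (tendsto_solFun_nodal_erase hpr hp hE ha i l).const_mul _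
  have hexact : ∀ k, exactForm q P (X ^ (k + 1)) ∈ V := fun k => mem_V.2 <| by
    simpa using tendsto_finsetSum univ fun l _ =>
      (tendsto_solFun_exactForm_X_pow hpr hp hE ha (k + 1) l).const_mul (c l)
  have hdvd : ¬ q ∣ g * q + 1 := by
    rw [Nat.dvd_add_right (dvd_mul_left _ _), Nat.dvd_one]
    exact hq.ne'
  have htest : testPoly g P u ∈ V :=
    mem_of_nodal_erase_mem_of_exactForm_mem hinj hdvd hnodal hexact _
  refine tendsto_nhds_unique (tendsto_const_nhds.congr' ?_) (mem_V.1 htest)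
  filter_upwards [eventually_gt_atTop 0] with s hs
  simp [P, solFun_testPoly hpr hp hE ha hs, Matrix.one_apply]

end Fiber

section Bundle

variable {K : Type*} [NontriviallyNormedField K] [IsUltrametricDist K] {p q g : ℕ}

theorem continuous_evalMatrix {R : Type*} [NormedField R] {n : ℕ} {α β : Type*}
    (M : Matrix α β (MvPolynomial (Fin n) ℤ)) :
    Continuous fun a : Fin n → R => evalMatrix M a := by
  refine continuous_matrix fun u v => ?_
  have h := MvPolynomial.continuous_eval (MvPolynomial.map (algebraMap ℤ R) (M u v))
  simp only [← MvPolynomial.eval₂_eq_eval_map] at h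
  exact h

theorem isOpen_kzDomain : IsOpen (kzDomain p q g K) := by
  have hball : IsOpen {a : Fin (g * q + 1) → K | ∀ i, ‖a i‖ ≤ 1} := by
    simpa [Set.pi] using isOpen_set_pi (i := (Set.univ : Set (Fin (g * q + 1))))
      Set.finite_univ fun i _ => IsUltrametricDist.isOpen_closedBall (0 : K) one_ne_zero
  have hdet : IsOpen {a : Fin (g * q + 1) → K |
      ‖(evalMatrix (hasseWitt p q g 1) a).det‖ = 1} := by
    simpa [Set.preimage] using (IsUltrametricDist.isOpen_sphere (0 : K) one_ne_zero).preimage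
      (continuous_evalMatrix (hasseWitt p q g 1)).matrix_det
  exact hball.inter hdet

theorem isOpen_kzDomainOff : IsOpen (kzDomainOff p q g K) := by
  have hne : IsOpen {a : Fin (g * q + 1) → K | ∀ i j, i ≠ j → a i ≠ a j} := by
    simp only [Set.ofPred_forall]
    exact isOpen_iInter_of_finite fun i => isOpen_iInter_of_finite fun j =>
      isOpen_iInter_of_finite fun _ => isOpen_ne_fun (continuous_apply i) (continuous_apply j)
  exact isOpen_kzDomain.inter hne

variable [CharZero K] [CompleteSpace K]

theorem finrank_fiberL (hpr : p.Prime) (hp : ‖(p : K)‖ < 1)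
    (hE : ExponentData (p ^ ordMod p q) q g (masterExp p q)) (hq : 1 < q)
    {a : Fin (g * q + 1) → K} (ha : a ∈ kzDomainOff p q g K) :
    Module.finrank K (fiberL p q g a) = g := by
  rw [fiberL, finrank_span_eq_card (linearIndependent_col_limitSol hpr hp hE hq ha),
    Fintype.card_fin]

theorem isAnalyticSubbundle_fiberL (hpr : p.Prime) (hp : ‖(p : K)‖ < 1)
    (hE : ExponentData (p ^ ordMod p q) q g (masterExp p q)) (hq : 1 < q) :
    IsAnalyticSubbundle (kzDomainOff p q g K) (fun a => fiberL p q g a) g := fun _ ha =>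
  ⟨_, isOpen_kzDomainOff, ha, subset_rfl, fun l x => (limitSol p q g x).col l,
    fun l _ hx => AnalyticAt.pi fun i => analyticAt_limitSol hpr hp hE hx.1 i l,
    fun _ hx => ⟨linearIndependent_col_limitSol hpr hp hE hq hx, rfl⟩⟩

end Bundle

section UnramifiedExt

variable (p m : ℕ) [Fact p.Prime]

instance : IsUltrametricDist (UnramifiedExt p m) where
  dist_triangle_max x y z := dist_triangle_max (x : PadicAlgCl p) y z

theorem norm_natCast_unramifiedExt_lt_one : ‖(p : UnramifiedExt p m)‖ < 1 := by
  calc ‖(p : UnramifiedExt p m)‖ = ‖((p : ℚ_[p]) : PadicAlgCl p)‖ := by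
        change ‖((p : UnramifiedExt p m) : PadicAlgCl p)‖ = _
        simp
    _ < 1 := by
        rw [PadicAlgCl.norm_extends]
        exact Padic.norm_p_lt_one

theorem finiteDimensional_unramifiedExt (hm : 0 < m) :
    FiniteDimensional ℚ_[p] (UnramifiedExt p m) := by
  have hpos : 0 < p ^ m - 1 :=
    Nat.sub_pos_of_lt (Nat.one_lt_pow hm.ne' (Fact.out : p.Prime).one_lt)
  have hfinite : {ζ : PadicAlgCl p | IsPrimitiveRoot ζ (p ^ m - 1)}.Finite := by
    classical
    refine (Polynomial.nthRoots (p ^ m - 1) (1 : PadicAlgCl p)).toFinset.finite_toSet.subset ?_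
    intro ζ hζ
    simpa [Polynomial.mem_nthRoots hpos] using hζ.pow_eq_one
  have := hfinite.to_subtype
  exact IntermediateField.finiteDimensional_adjoin fun x _ =>
    (Algebra.IsAlgebraic.isAlgebraic x).isIntegral

theorem completeSpace_unramifiedExt (hm : 0 < m) : CompleteSpace (UnramifiedExt p m) :=
  have := finiteDimensional_unramifiedExt p m hm
  FiniteDimensional.complete ℚ_[p] (UnramifiedExt p m)

end UnramifiedExt

end PadicKZ

end

open PadicKZ in
theorem mainTheorem12_general {K : Type*} [NontriviallyNormedField K] [IsUltrametricDist K]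
    [CharZero K] [CompleteSpace K] {p q g : ℕ} (hp : p.Prime) (hpK : ‖(p : K)‖ < 1)
    (hpq : p.Coprime q) (hq : 1 < q) (hg : g ≤ p ^ ordMod p q) :
    (∀ a ∈ kzDomain p q g K, ∀ s : ℕ, 1 ≤ s → ‖(evalMatrix (hasseWitt p q g s) a).det‖ = 1) ∧
    (∀ i l, TendstoUniformlyOn
      (fun (s : ℕ) (a : Fin (g * q + 1) → K) => normalizedSol p q g s a i l)
      (fun a => limitSol p q g a i l) atTop (kzDomain p q g K)) ∧
    (∀ i l, AnalyticOnNhd K (fun a : Fin (g * q + 1) → K => limitSol p q g a i l)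
      (kzDomain p q g K)) ∧
    (∀ a ∈ kzDomain p q g K, fiberL p q g a ≤ sumZero (g * q + 1) K) ∧
    (∀ a ∈ kzDomainOff p q g K, Module.finrank K (fiberL p q g a) = g) ∧
    IsAnalyticSubbundle (kzDomainOff p q g K) (fun a => fiberL p q g a) g :=
  have hE := exponentData_masterExp hp hpq hq hg
  ⟨fun _ ha _ hs => norm_det_hasseWitt hp hpK hE ha hs,
    tendstoUniformlyOn_normalizedSol hp hpK hE,
    fun i l _ ha => analyticAt_limitSol hp hpK hE ha i l,
    fun _ ha => fiberL_le_sumZero hp hpK hE ha,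
    fun _ ha => finrank_fiberL hp hpK hE hq ha,
    isAnalyticSubbundle_fiberL hp hpK hE hq⟩

theorem mainTheorem12 (p q g m : ℕ) [Fact p.Prime] (hq : q.Prime) (hqp : q < p)
    (hg : 0 < g) (hm : 0 < m)
    (hpe : g * q + 1 < p ^ PadicKZ.ordMod p q) (hpn : (g * q + 1) + q ≤ p + 2) :
    -- the matrices `A(Φ_s)(a)` are invertible on the domain
    (∀ a ∈ PadicKZ.kzDomain p q g (PadicKZ.UnramifiedExt p m), ∀ s : ℕ, 1 ≤ s →
      ‖(PadicKZ.evalMatrix (PadicKZ.hasseWitt p q g s) a).det‖ = 1) ∧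
    -- the limit that defines `𝓘` is uniform on the domain, and `𝓘` is analytic there
    (∀ i l, TendstoUniformlyOn
      (fun (s : ℕ) (a : Fin (g * q + 1) → PadicKZ.UnramifiedExt p m) =>
        PadicKZ.normalizedSol p q g s a i l)
      (fun a => PadicKZ.limitSol p q g a i l) atTop
      (PadicKZ.kzDomain p q g (PadicKZ.UnramifiedExt p m))) ∧
    (∀ i l, AnalyticOnNhd (PadicKZ.UnramifiedExt p m)
      (fun a : Fin (g * q + 1) → PadicKZ.UnramifiedExt p m => PadicKZ.limitSol p q g a i l)
      (PadicKZ.kzDomain p q g (PadicKZ.UnramifiedExt p m))) ∧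
    -- `𝓛_a` is a subspace of `W`
    (∀ a ∈ PadicKZ.kzDomain p q g (PadicKZ.UnramifiedExt p m),
      PadicKZ.fiberL p q g a ≤ PadicKZ.sumZero (g * q + 1) (PadicKZ.UnramifiedExt p m)) ∧
    -- the rank is constant, and `𝓛` is an analytic vector bundle off the diagonals
    ∃ r : ℕ,
      (∀ a ∈ PadicKZ.kzDomainOff p q g (PadicKZ.UnramifiedExt p m),
        Module.finrank (PadicKZ.UnramifiedExt p m) (PadicKZ.fiberL p q g a) = r) ∧
      PadicKZ.IsAnalyticSubbundle (K := PadicKZ.UnramifiedExt p m)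
        (PadicKZ.kzDomainOff p q g (PadicKZ.UnramifiedExt p m))
        (fun a => PadicKZ.fiberL p q g a) r := by
  have := PadicKZ.completeSpace_unramifiedExt p m hm
  have hpq : p.Coprime q := (Nat.coprime_primes Fact.out hq).2 hqp.ne'
  have hgp : g ≤ p ^ PadicKZ.ordMod p q := by
    have := Nat.le_mul_of_pos_right g hq.pos
    omega
  obtain ⟨hdet, hlim, han, hsum, hrank, hbundle⟩ := mainTheorem12_general (Fact.out : p.Prime)
    (PadicKZ.norm_natCast_unramifiedExt_lt_one p m) hpq hq.one_lt hgp
  exact ⟨hdet, hlim, han, hsum, g, hrank, hbundle⟩
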